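/- Let $c_1,c_2,\dots$ be indeterminates, let $$u(t)=t+\sum_{m\ge 1}c_m\frac{t^{m+1}}{m+1}\in\mathbb{Q}[c_1,c_2,\dots][[t]],$$ and let $t(u)=u-c_1\frac{u^2}{2!}+\cdots$ be its compositional inverse. The universal Bernoulli numbers $\hat B_m\in\mathbb{Q}[c_1,c_2,\dots]$ are defined by $$\frac{u}{t(u)}=\sum_{m\ge 0}\hat B_m\frac{u^m}{m!}.$$ Let $p$ be a prime number, and let $a$ and $n$ be positive integers such that $n>a$ and $n\not\equiv 0 \pmod{p-1}$. Then $$\sum_{r=0}^{a}\binom{a}{r}(-1)^r\,c_{p-1}^{\,a-r}\,\frac{\hat B_{n+r(p-1)}}{n+r(p-1)}\equiv 0 \pmod{p^{\lfloor a/2\rfloor}},$$ that is, the left-hand side belongs to $p^{\lfloor a/2\rfloor}\,\mathbb{Z}_{(p)}[c_1,c_2,\dots]$, where $\mathbb{Z}_{(p)}\subset\mathbb{Q}$ is the ring of rational numbers whose denominator is prime to $p$. -/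

import Mathlib

noncomputable section

namespace UnivBernoulli

/-- The indeterminate `c_n` of `ℚ[c₁, c₂, …]` for `n ≥ 1`, with the usual convention `c_0 = 1`. -/
def c (n : ℕ) : MvPolynomial ℕ+ ℚ :=
  if h : 0 < n then MvPolynomial.X ⟨n, h⟩ else 1

/-- The series `u(t) = t + ∑_{n ≥ 1} c_n t^(n+1) / (n+1)`. -/
def uSeries : PowerSeries (MvPolynomial ℕ+ ℚ) :=
  PowerSeries.X * PowerSeries.mk fun n => MvPolynomial.C (1 / ((n : ℚ) + 1)) * c n

theorem coeff_one_uSeries : PowerSeries.coeff 1 uSeries = 1 := by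
  have h := PowerSeries.coeff_succ_X_mul 0
    (PowerSeries.mk fun n => MvPolynomial.C (1 / ((n : ℚ) + 1)) * c n)
  rw [zero_add] at h
  rw [uSeries, h]
  simp [c]

theorem isUnit_coeff_one_uSeries : IsUnit (PowerSeries.coeff 1 uSeries) := by
  rw [coeff_one_uSeries]; exact isUnit_one

theorem constantCoeff_uSeries : PowerSeries.constantCoeff uSeries = 0 := by
  simp [uSeries]

/-- The series `t(u)`, the compositional inverse of `u(t)`. -/
def tSeries : PowerSeries (MvPolynomial ℕ+ ℚ) :=
  uSeries.substInvOfIsUnit isUnit_coeff_one_uSeries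

/-- `u(t(u)) = u`. -/
theorem uSeries_subst_tSeries : uSeries.subst tSeries = PowerSeries.X :=
  PowerSeries.subst_substInvOfIsUnit_right _ constantCoeff_uSeries _

theorem constantCoeff_tSeries : PowerSeries.constantCoeff tSeries = 0 :=
  PowerSeries.constantCoeff_substInvOfIsUnit _ _

theorem coeff_one_tSeries : PowerSeries.coeff 1 tSeries = 1 := by
  rw [tSeries, PowerSeries.coeff_one_substInvOfIsUnit]
  have h : isUnit_coeff_one_uSeries.unit = 1 := Units.ext coeff_one_uSeries
  rw [h, inv_one, Units.val_one]

/-- The series `u / t(u)`: the inverse of `t(u) / u = ∑_n (coeff (n+1) t) u^n`,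
whose constant term is `1`. -/
def bernoulliSeries : PowerSeries (MvPolynomial ℕ+ ℚ) :=
  PowerSeries.invOfUnit (PowerSeries.mk fun n => PowerSeries.coeff (n + 1) tSeries) 1

/-- `(u / t(u)) * t(u) = u`. -/
theorem bernoulliSeries_mul_tSeries : bernoulliSeries * tSeries = PowerSeries.X := by
  have ht : tSeries =
      (PowerSeries.mk fun n => PowerSeries.coeff (n + 1) tSeries) * PowerSeries.X := by
    conv_lhs => rw [PowerSeries.eq_shift_mul_X_add_const tSeries, constantCoeff_tSeries]
    simp
  have hinv : bernoulliSeries *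
      (PowerSeries.mk fun n => PowerSeries.coeff (n + 1) tSeries) = 1 := by
    refine PowerSeries.invOfUnit_mul _ _ ?_
    simpa using coeff_one_tSeries
  rw [ht, ← mul_assoc, hinv, one_mul]

/-- The universal Bernoulli number `B̂_n`, defined by `u / t(u) = ∑_n B̂_n u^n / n!`. -/
def univBernoulli (n : ℕ) : MvPolynomial ℕ+ ℚ :=
  MvPolynomial.C (n.factorial : ℚ) * PowerSeries.coeff n bernoulliSeries

/-- The ring `ℤ_(p)` of rational numbers whose denominator is prime to `p`,
as a subring of `ℚ`. -/
def zLoc (p : ℕ) [Fact p.Prime] : Subring ℚ :=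
  (Rat.padicValuation p).integer

theorem mem_zLoc_iff (p : ℕ) [Fact p.Prime] (x : ℚ) : x ∈ zLoc p ↔ p.Coprime x.den := by
  rw [zLoc, Valuation.mem_integer_iff, Rat.padicValuation_le_one_iff,
    Nat.Prime.coprime_iff_not_dvd Fact.out]

/-- `f ≡ 0 mod p^k` in `ℤ_(p)[c₁, c₂, …]`: `f` is `p^k` times a polynomial
with coefficients in `ℤ_(p)`. -/
def CongZero (p : ℕ) [Fact p.Prime] (k : ℕ) (f : MvPolynomial ℕ+ ℚ) : Prop :=
  ∃ g : MvPolynomial ℕ+ (zLoc p),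
    f = MvPolynomial.C ((p : ℚ) ^ k) * MvPolynomial.map (zLoc p).subtype g

end UnivBernoulli

end

/-! The proof is coefficientwise. Lagrange inversion gives Clarke's formula
(`coeff_divided_univBernoulli`): for `weight U = n` the coefficient of `c^U` in `B̂_n / n` is, up to
sign, `(n + d - 2)! / γ_U`, with `d = deg U` and `γ_U = ∏ (j+1)^(U_j) U_j!`.

Fix a monomial `c^W c_{p-1}^m` with `W` free of `c_{p-1}`, put `N = weight W + deg W - 2` and `q =
⌊N/p⌋`. Removing the multiples of `p` from the factorials turns the coefficient of the sum into `±
p^q q! / γ_W` times an `a`-th difference of `t ↦ C(t,q) (-1)^t F(N mod p + pt)`, where `F` is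
`primeToFactorial` (`coeff_kummer_sum`). By Wilson's theorem each two differences of `(-1)^t F` gain
at least one `p`, and at most `q` differences are absorbed by `C(t,q)`, so `p^⌈(a-q)/2⌉` divides the
difference (`pow_dvd_fwdDiff_iter_choose_mul`), the exponent being `0` if `q ≥ a`. Since `n ≢ 0 mod
p - 1`, the prefactor has valuation at least `⌊q/2⌋` (`factorization_gam_le`). The two exponents add
up to at least `⌊a/2⌋`. -/

/-! ### Iterated differences. -/

open Polynomial in
theorem Polynomial.exists_comp_X_add_natCast_sub (p : ℕ) (P : ℤ[X]) :
    ∃ P₁ : ℤ[X], P.comp (X + C (p : ℤ)) - P = C (p : ℤ) * P₁ := by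
  -- With coefficients mapped to constants in `ℤ[X]`, composition becomes evaluation, and `x - y ∣
  -- f(x) - f(y)` applies.
  have h := Polynomial.sub_dvd_eval_sub (X + C (p : ℤ)) X (P.map C)
  rw [add_sub_cancel_left, eval_map, eval_map, ← comp, ← comp, comp_X] at h
  exact h

/-- Divisibility form of the Leibniz rule for iterated differences. -/
theorem dvd_fwdDiff_iter_mul {d : ℤ} (b : ℕ) (f g : ℕ → ℤ)
    (h : ∀ i j x y, i + j = b → d ∣ (fwdDiff 1)^[i] f x * (fwdDiff 1)^[j] g y) (x : ℕ) :
    d ∣ (fwdDiff 1)^[b] (fun y => f y * g y) x := by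
  induction b generalizing f g with
  | zero => exact h 0 0 x x rfl
  | succ b ih =>
    have hD : fwdDiff 1 (fun y => f y * g y) =
        (fun y => fwdDiff 1 f y * g (y + 1)) + fun y => f y * fwdDiff 1 g y := by
      funext y
      simp only [fwdDiff, Pi.add_apply]
      ring
    rw [Function.iterate_succ_apply, hD, fwdDiff_iter_add, Pi.add_apply]
    refine dvd_add (ih _ _ fun i j x y hij => ?_) (ih _ _ fun i j x y hij => ?_)
    -- The shift of `g` is harmless because `h` allows independent base points.
    · rw [fwdDiff_iter_comp_add, ← Function.iterate_succ_apply]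
      exact h _ _ _ _ (by omega)
    · rw [← Function.iterate_succ_apply (fwdDiff 1) j g]
      exact h _ _ _ _ (by omega)

theorem pow_dvd_fwdDiff_iter_eval_mul (p : ℕ) (i : ℕ) (P : Polynomial ℤ) (x : ℕ) :
    (p : ℤ) ^ i ∣ (fwdDiff 1)^[i] (fun y : ℕ => P.eval ((p : ℤ) * y)) x := by
  induction i generalizing P with
  | zero => simp
  | succ i ih =>
    obtain ⟨P₁, hP₁⟩ := Polynomial.exists_comp_X_add_natCast_sub p P
    have hD : fwdDiff 1 (fun y : ℕ => P.eval ((p : ℤ) * y)) =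
        (p : ℤ) • fun y : ℕ => P₁.eval ((p : ℤ) * y) := by
      funext y
      have h := congrArg (Polynomial.eval ((p : ℤ) * y)) hP₁
      simp only [Polynomial.eval_sub, Polynomial.eval_comp, Polynomial.eval_add,
        Polynomial.eval_X, Polynomial.eval_C, Polynomial.eval_mul] at h
      simp only [fwdDiff, Pi.smul_apply, smul_eq_mul, ← h, Nat.cast_add, Nat.cast_one, mul_add,
        mul_one]
    rw [Function.iterate_succ_apply, hD, fwdDiff_iter_const_smul, Pi.smul_apply, smul_eq_mul,
      pow_succ']
    exact mul_dvd_mul_left _ (ih P₁)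

/-! ### Factorials stripped of their multiples of `p`. -/

/-- The product of the positive integers up to `K` that are prime to `p`. -/
def primeToFactorial (p K : ℕ) : ℕ := ∏ i ∈ Finset.range K, if p ∣ i + 1 then 1 else i + 1

theorem factorial_eq_pow_mul_primeToFactorial (p K : ℕ) :
    K.factorial = p ^ (K / p) * (K / p).factorial * primeToFactorial p K := by
  induction K with
  | zero => simp [primeToFactorial]
  | succ K ih =>
    rw [primeToFactorial, Finset.prod_range_succ, ← primeToFactorial, Nat.factorial_succ,
      Nat.succ_div, ih]
    split_ifs with h
    · have : p * (K / p + 1) = K + 1 := by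
        have h2 := Nat.mul_div_cancel' h
        rwa [Nat.succ_div_of_dvd h] at h2
      rw [Nat.factorial_succ, ← this]
      ring
    · rw [add_zero]
      ring

/-- The factors are `p`-periodic in `ZMod p`, so sliding the window by one drops and regains the
same nonzero factor. This reduces to Wilson's theorem at `K = 0`. -/
theorem prod_range_shift_wilson (p : ℕ) [Fact p.Prime] (K : ℕ) :
    ∏ i ∈ Finset.range p, (if p ∣ K + i + 1 then (1 : ZMod p) else ((K + i + 1 : ℕ) : ZMod p))
      = -1 := by
  set g : ℕ → ZMod p := fun j => if p ∣ j + 1 then 1 else ((j + 1 : ℕ) : ZMod p) with hg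
  have hg0 (j) : g j ≠ 0 := by
    simp only [hg]
    split_ifs with h
    · exact one_ne_zero
    · rwa [Ne, ZMod.natCast_eq_zero_iff]
  have hgp (j) : g (j + p) = g j := by
    have : p ∣ j + p + 1 ↔ p ∣ j + 1 := by
      rw [add_right_comm]; exact Nat.dvd_add_left (dvd_refl p)
    simp only [hg, this]
    congr 1
    push_cast
    simp
  change ∏ i ∈ Finset.range p, g (K + i) = -1
  induction K with
  | zero =>
    obtain ⟨m, hm⟩ : ∃ m, p = m + 1 := ⟨p - 1, by have := (Fact.out : p.Prime).pos; omega⟩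
    have hw := ZMod.wilsons_lemma p
    have hlast : g m = 1 := by simp [hg, ← hm]
    have hfac : ((p - 1).factorial : ZMod p) = ∏ i ∈ Finset.range m, g i := by
      rw [show p - 1 = m by omega, ← Finset.prod_range_add_one_eq_factorial, Nat.cast_prod]
      refine Finset.prod_congr rfl fun i hi => ?_
      rw [Finset.mem_range] at hi
      simp only [hg]
      rw [if_neg (Nat.not_dvd_of_pos_of_lt (by omega) (by omega))]
    simp only [zero_add]
    rw [← hw, hfac, show Finset.range p = Finset.range (m + 1) by rw [← hm],
      Finset.prod_range_succ, hlast, mul_one]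
  | succ K ih =>
    rw [← ih]
    have h1 := Finset.prod_range_succ (fun i => g (K + i)) p
    rw [Finset.prod_range_succ', hgp, add_zero] at h1
    refine Eq.trans (Finset.prod_congr rfl fun i _ => ?_) (mul_right_cancel₀ (hg0 K) h1)
    congr 1
    ring

open Polynomial in
theorem primeToFactorial_add_prime (p : ℕ) [Fact p.Prime] (r : ℕ) : ∃ P : ℤ[X], ∀ t : ℕ,
    (p : ℤ) ∣ P.eval ((p : ℤ) * t) ∧
    (primeToFactorial p (r + p * (t + 1)) : ℤ) =
      - primeToFactorial p (r + p * t) * (1 + P.eval ((p : ℤ) * t)) := by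
  refine ⟨-(∏ i ∈ Finset.range p, if p ∣ r + i + 1 then 1 else (X + C ((r + i + 1 : ℕ) : ℤ))) - 1,
    fun t => ?_⟩
  have hd (i : ℕ) : p ∣ r + p * t + i + 1 ↔ p ∣ r + i + 1 := by
    rw [show r + p * t + i + 1 = r + i + 1 + p * t by ring]
    exact Nat.dvd_add_left (dvd_mul_right p t)
  have he : (∏ i ∈ Finset.range p,
      if p ∣ r + i + 1 then (1 : ℤ[X]) else (X + C ((r + i + 1 : ℕ) : ℤ))).eval ((p : ℤ) * t) =
      ((∏ i ∈ Finset.range p, if p ∣ r + p * t + i + 1 then 1 else (r + p * t + i + 1) : ℕ) : ℤ) := by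
    rw [eval_prod, Nat.cast_prod]
    refine Finset.prod_congr rfl fun i _ => ?_
    simp only [hd]
    split_ifs
    · simp
    · simp only [eval_add, eval_X, eval_C]
      push_cast
      ring
  simp only [eval_sub, eval_neg, eval_one, he]
  refine ⟨?_, ?_⟩
  · rw [← ZMod.intCast_zmod_eq_zero_iff_dvd]
    have h := prod_range_shift_wilson p (r + p * t)
    push_cast at h ⊢
    rw [h]
    ring
  · rw [mul_add, mul_one, ← add_assoc, primeToFactorial, Finset.prod_range_add, ← primeToFactorial]
    push_cast
    ring

/-- One difference multiplies the function by `P(pt)`. The Leibniz rule then brings in fewer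
differences of the same function, hence strong induction. -/
theorem pow_dvd_fwdDiff_iter_primeToFactorial (p : ℕ) [Fact p.Prime] (r b x : ℕ) :
    (p : ℤ) ^ ((b + 1) / 2) ∣
      (fwdDiff 1)^[b] (fun t : ℕ => (-1 : ℤ) ^ t * primeToFactorial p (r + p * t)) x := by
  obtain ⟨P, hP⟩ := primeToFactorial_add_prime p r
  induction b using Nat.strong_induction_on generalizing x with
  | _ b ih =>
  rcases b with _ | b
  · simp
  have hD : fwdDiff 1 (fun t : ℕ => (-1 : ℤ) ^ t * primeToFactorial p (r + p * t)) =
      fun t : ℕ => ((-1 : ℤ) ^ t * primeToFactorial p (r + p * t)) * P.eval ((p : ℤ) * t) := by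
    funext t
    rw [fwdDiff, (hP t).2]
    ring
  rw [Function.iterate_succ_apply, hD]
  refine dvd_fwdDiff_iter_mul b _ _ (fun i j y z hij => ?_) x
  have h1 := ih i (by omega) y
  -- For `j = 0` the factor `p` comes from Wilson's theorem; for `j ≥ 1` from the argument being a
  -- multiple of `p`.
  have h2 : (p : ℤ) ^ (max 1 j) ∣ (fwdDiff 1)^[j] (fun y : ℕ => P.eval ((p : ℤ) * y)) z := by
    rcases j with _ | j
    · simpa using (hP z).1
    · rw [max_eq_right (by omega)]
      exact pow_dvd_fwdDiff_iter_eval_mul p _ P z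
  refine dvd_trans ?_ (mul_dvd_mul h1 h2)
  rw [← pow_add]
  exact pow_dvd_pow _ (by omega)

theorem pow_dvd_fwdDiff_iter_choose_mul (p : ℕ) [Fact p.Prime] (r q a x : ℕ) :
    (p : ℤ) ^ ((a - q + 1) / 2) ∣ (fwdDiff 1)^[a] (fun t : ℕ => (t.choose q : ℤ) *
      ((-1 : ℤ) ^ t * primeToFactorial p (r + p * t))) x := by
  refine dvd_fwdDiff_iter_mul a _ _ (fun i j y z hij => ?_) x
  -- The binomial coefficient has degree `q` in `t`: it absorbs at most `q` differences, and more
  -- annihilate it.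
  rcases le_or_gt i q with hi | hi
  · exact ((pow_dvd_pow _ (by omega)).trans
      (pow_dvd_fwdDiff_iter_primeToFactorial p r j z)).mul_left _
  · obtain ⟨k, rfl⟩ : ∃ k, i = k + 1 + q := ⟨i - q - 1, by omega⟩
    have h := fwdDiff_iter_choose 0 q
    simp only [add_zero, Nat.choose_zero_right, Nat.cast_one] at h
    rw [Function.iterate_add_apply, h, Function.iterate_succ_apply, fwdDiff_const]
    have h0 : (fwdDiff 1)^[k] (fun _ : ℕ => (0 : ℤ)) y = 0 := by
      rw [fwdDiff_iter_eq_sum_shift]; simp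
    rw [h0, zero_mul]
    exact dvd_zero _

/-! ### Valuation of the denominators `γ_W`. -/

-- Counting partitions of `eW` points into `W` blocks of size `e` shows `e!^W W! ∣ (eW)!`, and `e ∣
-- e!`.
open Nat in
theorem Nat.pow_mul_factorial_dvd {e : ℕ} (he : e ≠ 0) (W : ℕ) : e ^ W * W ! ∣ (e * W)! := by
  have h := Nat.uniformBell_mul_eq W he
  rw [mul_comm e W, ← h]
  refine mul_dvd_mul (Dvd.dvd.mul_left ?_ _) dvd_rfl
  exact pow_dvd_pow_of_dvd (Nat.dvd_factorial (Nat.pos_of_ne_zero he) le_rfl) _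

open Nat

theorem factorization_factorial_div {p : ℕ} (hp : p.Prime) (W : ℕ) :
    (W !).factorization p = W / p + ((W / p)!).factorization p := by
  have := Fact.mk hp
  have h1 := padicValNat_factorial_mul (p := p) (W / p)
  rw [padicValNat_mul_div_factorial] at h1
  rw [Nat.factorization_def _ hp, Nat.factorization_def _ hp, h1, add_comm]

theorem factorization_mono {p a b : ℕ} (hb : b ≠ 0) (h : a ∣ b) :
    a.factorization p ≤ b.factorization p :=
  (Nat.factorization_le_iff_dvd (ne_zero_of_dvd_ne_zero hb h) hb).2 h p

/-- Powers of `p` are `1` modulo `p - 1`, so `e = p^k m` with `p ∤ m` and `m ≥ 2`. Only `p^k`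
matters for the valuation, and `p^k W ≤ eW - 1` leaves room for the loss of one. -/
theorem factorization_pow_mul_factorial_le {p e W : ℕ} (hp : p.Prime) (he : e ≠ 0) (hW : W ≠ 0)
    (h : ¬ e ≡ 1 [MOD (p - 1)]) :
    (e ^ W * W !).factorization p ≤ ((e * W - 1)!).factorization p := by
  obtain ⟨k, m, hm, rfl⟩ := Nat.exists_eq_pow_mul_and_not_dvd he p hp.ne_one
  have hm0 : m ≠ 0 := by rintro rfl; simp at hm
  have hm1 : m ≠ 1 := by
    rintro rfl
    apply h
    have : p ≡ 1 [MOD (p - 1)] := by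
      have := (Nat.modEq_sub hp.one_le)
      exact this
    simpa using this.pow k
  have hpk : 0 < p ^ k := pow_pos hp.pos k
  have h1 : ((p ^ k * m) ^ W * W !).factorization p = ((p ^ k) ^ W * W !).factorization p := by
    have : m.factorization p = 0 := Nat.factorization_eq_zero_of_not_dvd hm
    rw [mul_pow, Nat.factorization_mul (by positivity) (by positivity),
      Nat.factorization_mul (by positivity) (by positivity),
      Nat.factorization_mul (by positivity) (by positivity)]
    simp [this]
  rw [h1]
  refine factorization_mono (Nat.factorial_ne_zero _)
    ((Nat.pow_mul_factorial_dvd hpk.ne' _).trans (Nat.factorial_dvd_factorial ?_))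
  have h2 : 2 ≤ m := by omega
  have h3 : 1 ≤ p ^ k * W := Nat.mul_pos hpk (Nat.pos_of_ne_zero hW)
  have h4 : p ^ k * W * 2 ≤ p ^ k * W * m := Nat.mul_le_mul_left _ h2
  have h5 : p ^ k * m * W = p ^ k * W * m := by ring
  omega

/-- One part size `l` with multiplicity `W`. -/
theorem exists_factorization_part {p l W : ℕ} (hp : p.Prime) (hl : 2 ≤ l) (hlp : l ≠ p) :
    ∃ h k : ℕ, 2 * p * h ≤ l * W ∧ p * k ≤ l * W ∧
      (l ^ W * W !).factorization p ≤ h + (k !).factorization p ∧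
      (W ≠ 0 → ¬ l ≡ 1 [MOD (p - 1)] → ∃ k', p * k' + 2 ≤ l * W ∧
        (l ^ W * W !).factorization p ≤ h + (k' !).factorization p) := by
  have hp2 := hp.two_le
  by_cases hd : p ∣ l
  · obtain ⟨e, rfl⟩ := hd
    have he : 2 ≤ e := by
      rcases e with _ | _ | e
      · simp at hl
      · simp at hlp
      · omega
    have hv : ((p * e) ^ W * W !).factorization p = W + (e ^ W * W !).factorization p := by
      have h0 : e ^ W * W ! ≠ 0 := by positivity
      rw [mul_pow, mul_assoc, Nat.factorization_mul (by positivity) h0]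
      simp [hp.factorization_self]
    -- `h = W` counts the factor `p^W` of `(pe)^W`; `2ph ≤ lW` holds because `l ≠ p` forces `e ≥ 2`.
    refine ⟨W, e * W, ?_, (mul_assoc _ _ _).ge, ?_, fun hW hmod => ⟨e * W - 1, ?_, ?_⟩⟩
    · calc 2 * p * W = p * 2 * W := by ring
        _ ≤ p * e * W := by gcongr
    · rw [hv]
      exact Nat.add_le_add_left
        (factorization_mono (Nat.factorial_ne_zero _) (Nat.pow_mul_factorial_dvd (by omega) W)) _
    · obtain ⟨x, hx⟩ : ∃ x, e * W = x + 1 :=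
        ⟨e * W - 1, by have : 0 < e * W := by positivity
                       omega⟩
      rw [mul_assoc, hx, Nat.add_sub_cancel, mul_add, mul_one]
      omega
    · rw [hv]
      refine Nat.add_le_add_left (factorization_pow_mul_factorial_le hp (by omega) hW ?_) _
      intro h
      apply hmod
      have hp1 : p ≡ 1 [MOD (p - 1)] := Nat.modEq_sub hp.one_le
      simpa using hp1.mul h
  · have hv : (l ^ W * W !).factorization p = W / p + ((W / p)!).factorization p := by
      rw [Nat.factorization_mul (by positivity) (by positivity), Finsupp.add_apply,
        Nat.factorization_pow, Finsupp.smul_apply, Nat.factorization_eq_zero_of_not_dvd hd,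
        smul_zero, zero_add, factorization_factorial_div hp]
    have hW' : p * (W / p) ≤ W := Nat.mul_div_le W p
    have hle : l * (p * (W / p)) ≤ l * W := Nat.mul_le_mul_left _ hW'
    have hdv {x y : ℕ} (h : x ≤ y) : (x !).factorization p ≤ (y !).factorization p :=
      factorization_mono (Nat.factorial_ne_zero _) (Nat.factorial_dvd_factorial h)
    have hlW : 2 * (W / p) ≤ l * (W / p) := Nat.mul_le_mul_right _ hl
    refine ⟨W / p, l * (W / p), ?_, ?_, ?_, fun hW _ => ⟨l * (W / p) - 1, ?_, ?_⟩⟩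
    · refine le_trans ?_ hle
      calc 2 * p * (W / p) = 2 * (p * (W / p)) := by ring
        _ ≤ _ := Nat.mul_le_mul_right _ hl
    · refine le_trans (le_of_eq (by ring)) hle
    · rw [hv]
      exact Nat.add_le_add_left (hdv (by omega)) _
    · rcases Nat.eq_zero_or_pos (W / p) with h0 | h0
      · rw [h0]
        simp only [mul_zero, Nat.zero_sub, zero_add]
        calc 2 = 2 * 1 := rfl
          _ ≤ l * W := Nat.mul_le_mul hl (by omega)
      · obtain ⟨x, hx⟩ : ∃ x, l * (W / p) = x + 1 := ⟨l * (W / p) - 1, by omega⟩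
        have h1 : l * (p * (W / p)) = p * (l * (W / p)) := by ring
        rw [h1, hx, mul_add, mul_one] at hle
        rw [hx, Nat.add_sub_cancel]
        omega
    · rw [hv]
      exact Nat.add_le_add_left (hdv (by omega)) _

/-- The `p`-part of the order of the centralizer of a permutation of `M` letters with `W i`
cycles of length `l i`, compared with `(M - 2)!`. -/
theorem factorization_centralizer_le {ι : Type*} {p : ℕ} (hp : p.Prime) (hp3 : 3 ≤ p)
    (s : Finset ι) (l W : ι → ℕ) (hl : ∀ i ∈ s, 2 ≤ l i) (hlp : ∀ i ∈ s, l i ≠ p)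
    (hex : ∃ i ∈ s, W i ≠ 0 ∧ ¬ l i ≡ 1 [MOD (p - 1)]) {N : ℕ}
    (hN : ∑ i ∈ s, l i * W i = N + 2) :
    (∏ i ∈ s, (l i ^ W i * (W i)!)).factorization p + N / p / 2 ≤ (N !).factorization p := by
  classical
  choose! h k h1 h2 h3 h4 using fun i (hi : i ∈ s) =>
    exists_factorization_part (W := W i) hp (hl i hi) (hlp i hi)
  -- The exceptional part uses the sharper bound `p * k' + 2 ≤ l * W`; its slack of `2` absorbs the
  -- difference between `N + 2` and `N`.
  obtain ⟨i₀, hi₀, hW₀, hmod⟩ := hex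
  obtain ⟨k₀, hk₀, hv₀⟩ := h4 i₀ hi₀ hW₀ hmod
  have hv : (∏ i ∈ s, (l i ^ W i * (W i)!)).factorization p ≤
      ∑ i ∈ s, h i + ((k₀ + ∑ i ∈ s.erase i₀, k i)!).factorization p := by
    rw [Nat.factorization_prod (fun i hi => by have := hl i hi; positivity), Finsupp.finsetSum_apply,
      ← Finset.add_sum_erase s _ hi₀, ← Finset.add_sum_erase s h hi₀]
    have hsum : ∑ i ∈ s.erase i₀, (l i ^ W i * (W i)!).factorization p ≤
        ∑ i ∈ s.erase i₀, h i + ∑ i ∈ s.erase i₀, ((k i)!).factorization p := by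
      rw [← Finset.sum_add_distrib]
      exact Finset.sum_le_sum fun i hi => h3 i (Finset.mem_of_mem_erase hi)
    have hk : ∑ i ∈ s.erase i₀, ((k i)!).factorization p ≤
        ((∑ i ∈ s.erase i₀, k i)!).factorization p := by
      rw [← Finsupp.finsetSum_apply,
        ← Nat.factorization_prod (fun i _ => Nat.factorial_ne_zero _)]
      exact factorization_mono (Nat.factorial_ne_zero _)
        (Nat.prod_factorial_dvd_factorial_sum _ _)
    have hadd : (k₀ !).factorization p + ((∑ i ∈ s.erase i₀, k i)!).factorization p ≤
        ((k₀ + ∑ i ∈ s.erase i₀, k i)!).factorization p := by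
      rw [← Finsupp.add_apply, ← Nat.factorization_mul (Nat.factorial_ne_zero _)
        (Nat.factorial_ne_zero _)]
      exact factorization_mono (Nat.factorial_ne_zero _) (Nat.factorial_mul_factorial_dvd_factorial_add _ _)
    omega
  have hq : k₀ + ∑ i ∈ s.erase i₀, k i ≤ N / p := by
    rw [Nat.le_div_iff_mul_le hp.pos, mul_comm, mul_add, Finset.mul_sum]
    have : ∑ i ∈ s.erase i₀, p * k i ≤ ∑ i ∈ s.erase i₀, l i * W i :=
      Finset.sum_le_sum fun i hi => h2 i (Finset.mem_of_mem_erase hi)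
    rw [← Finset.add_sum_erase s _ hi₀] at hN
    omega
  -- Hence the sum of the `h i` is at most `q - ⌊q/2⌋` with `q = N / p`, while the valuation of `N!`
  -- is `q` plus that of `q!`.
  have hG : 2 * ∑ i ∈ s, h i ≤ N / p + 1 := by
    have h5 : 2 * p * ∑ i ∈ s, h i ≤ N + 2 := by
      rw [Finset.mul_sum, ← hN]
      exact Finset.sum_le_sum h1
    have h6 := Nat.lt_mul_div_succ N hp.pos
    by_contra! hlt
    have h7 : p * (N / p + 1 + 1) ≤ p * (2 * ∑ i ∈ s, h i) := Nat.mul_le_mul_left _ hlt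
    have h8 : p * (2 * ∑ i ∈ s, h i) = 2 * p * ∑ i ∈ s, h i := by ring
    rw [mul_add] at h7
    omega
  have hmono : ((k₀ + ∑ i ∈ s.erase i₀, k i)!).factorization p ≤ ((N / p)!).factorization p :=
    factorization_mono (Nat.factorial_ne_zero _) (Nat.factorial_dvd_factorial hq)
  rw [factorization_factorial_div hp N]
  omega

/-! ### Lagrange inversion by formal residues. -/

namespace PowerSeries

variable {R : Type*} [CommRing R]

theorem derivative_inverse {G I : PowerSeries R} (hI : I * G = 1) :
    derivative R I = -(I ^ 2 * derivative R G) := by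
  have h := congrArg (derivative R) hI
  rw [derivative_one, Derivation.leibniz, smul_eq_mul, smul_eq_mul] at h
  linear_combination I * h - derivative R I * hI

theorem derivative_inverse_pow {G I : PowerSeries R} (hI : I * G = 1) (n : ℕ) :
    derivative R (I ^ n) = -((n : PowerSeries R) * I ^ (n + 1) * derivative R G) := by
  rcases n with _ | n
  · simp
  · rw [derivative_pow, derivative_inverse hI, Nat.add_sub_cancel]
    ring

/-- With `u = X * G` the coefficient is the residue of `u'/u^(n+1)`; times `n` it is, up to sign,
the residue of the derivative of `u^(-n)`. -/
theorem natCast_mul_coeff_pow_mul_derivative {G I : PowerSeries R} (hI : I * G = 1) (n : ℕ) :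
    (n : R) * coeff n (derivative R (X * G) * I ^ (n + 1)) = 0 := by
  have hu : derivative R (X * G) * I ^ (n + 1) = I ^ n + X * (derivative R G * I ^ (n + 1)) := by
    rw [Derivation.leibniz, derivative_X, smul_eq_mul, smul_eq_mul]
    linear_combination I ^ n * hI
  rcases n with _ | n
  · simp
  have h := congrArg (coeff n) (derivative_inverse_pow hI (n + 1))
  rw [coeff_derivative, mul_assoc, ← map_natCast (C (R := R)), map_neg, coeff_C_mul] at h
  rw [hu, map_add, coeff_succ_X_mul, mul_comm (derivative R G)]
  push_cast at h ⊢
  linear_combination h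

/-- The residue form of the Lagrange inversion theorem, for the change of variable `u = X * G`. -/
theorem coeff_subst_mul_derivative_mul_pow [IsDomain R] [CharZero R] {G I : PowerSeries R}
    (hI : I * G = 1) (hG : constantCoeff G = 1) (n : ℕ) (F : PowerSeries R) :
    coeff n (F.subst (X * G) * (derivative R (X * G) * I ^ (n + 1))) = coeff n F := by
  have hs : HasSubst (X * G) := HasSubst.of_constantCoeff_zero' (by simp)
  have hI0 : constantCoeff I = 1 := by
    have h := congrArg constantCoeff hI
    rwa [map_mul, hG, mul_one, map_one] at h
  have hF (F : PowerSeries R) : F.subst (X * G) =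
      X * G * (mk fun m => coeff (m + 1) F).subst (X * G) + C (constantCoeff F) := by
    conv_lhs => rw [eq_X_mul_shift_add_const F]
    rw [subst_add hs, subst_mul hs, subst_X hs, subst_C]
    rfl
  have hu0 : constantCoeff (derivative R (X * G)) = 1 := by
    rw [Derivation.leibniz, derivative_X, smul_eq_mul, smul_eq_mul]
    simp [hG]
  -- Split off the constant term of `F`: it contributes a vanishing residue, and the rest is
  -- divisible by `u`, which lowers `n`.
  induction n generalizing F with
  | zero =>
    rw [hF]
    simp [hI0, hG]
  | succ n ih =>
    have hz : coeff (n + 1) (derivative R (X * G) * I ^ (n + 1 + 1)) = 0 := by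
      have h := natCast_mul_coeff_pow_mul_derivative hI (n + 1)
      exact (mul_eq_zero.1 h).resolve_left (Nat.cast_ne_zero.2 n.succ_ne_zero)
    have hsplit : F.subst (X * G) * (derivative R (X * G) * I ^ (n + 1 + 1)) =
        X * ((mk fun m => coeff (m + 1) F).subst (X * G) *
          (derivative R (X * G) * I ^ (n + 1))) +
        C (constantCoeff F) * (derivative R (X * G) * I ^ (n + 1 + 1)) := by
      rw [hF F]
      linear_combination X * (mk fun m => coeff (m + 1) F).subst (X * G) *
          (derivative R (X * G) * I ^ (n + 1)) * hI
    rw [hsplit, map_add, coeff_succ_X_mul, ih, coeff_C_mul, hz, mul_zero, add_zero, coeff_mk]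

/-- Lagrange inversion for `G` expressed as a series in `X * G`. -/
theorem natCast_mul_coeff_of_subst_eq [IsDomain R] [CharZero R] {G I b : PowerSeries R}
    (hI : I * G = 1) (hG : constantCoeff G = 1) (hb : b.subst (X * G) = G) (n : ℕ) :
    (n : R) * coeff (n + 1) b = -coeff (n + 1) (I ^ n) := by
  have hs : HasSubst (X * G) := HasSubst.of_constantCoeff_zero' (by simp)
  have h1 := coeff_subst_mul_derivative_mul_pow hI hG n (derivative R b)
  have h2 : (derivative R b).subst (X * G) * (derivative R (X * G) * I ^ (n + 1)) =
      derivative R G * I ^ (n + 1) := by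
    rw [← mul_assoc, ← derivative_subst hs, hb]
  have h3 := congrArg (coeff n) (derivative_inverse_pow hI n)
  rw [h2, coeff_derivative] at h1
  rw [coeff_derivative, mul_assoc, ← map_natCast (C (R := R)), map_neg, coeff_C_mul,
    mul_comm (I ^ (n + 1)), h1] at h3
  have h4 : (n : R) + 1 ≠ 0 := by exact_mod_cast n.succ_ne_zero
  apply mul_left_cancel₀ h4
  linear_combination h3

end PowerSeries

/-! ### Clarke's formula. -/

namespace UnivBernoulli

open MvPolynomial

theorem c_coe (m : ℕ+) : c m = X m := dif_pos m.pos

theorem c_zero : c 0 = 1 := rfl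

/-- The series `u(t) / t`. -/
noncomputable def uShift : PowerSeries (MvPolynomial ℕ+ ℚ) :=
  PowerSeries.mk fun n => C (1 / ((n : ℚ) + 1)) * c n

theorem uSeries_eq : uSeries = PowerSeries.X * uShift := rfl

theorem constantCoeff_uShift : PowerSeries.constantCoeff uShift = 1 := by
  simp [uShift, c]

/-- The series `t / u(t)`. -/
noncomputable def uShiftInv : PowerSeries (MvPolynomial ℕ+ ℚ) := PowerSeries.invOfUnit uShift 1

theorem uShiftInv_mul : uShiftInv * uShift = 1 :=
  PowerSeries.invOfUnit_mul _ _ (by rw [constantCoeff_uShift, Units.val_one])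

theorem bernoulliSeries_subst : bernoulliSeries.subst uSeries = uShift := by
  have hs : PowerSeries.HasSubst uSeries :=
    PowerSeries.HasSubst.of_constantCoeff_zero' constantCoeff_uSeries
  have h := congrArg (PowerSeries.subst uSeries) bernoulliSeries_mul_tSeries
  have ht : tSeries.subst uSeries = PowerSeries.X :=
    PowerSeries.subst_substInvOfIsUnit_left _ constantCoeff_uSeries _
  rw [PowerSeries.subst_mul hs, PowerSeries.subst_X hs, ht, mul_comm] at h
  conv_rhs at h => rw [uSeries_eq]
  exact mul_left_cancel₀ PowerSeries.X_ne_zero h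

theorem natCast_mul_coeff_bernoulliSeries (n : ℕ) :
    (n : MvPolynomial ℕ+ ℚ) * PowerSeries.coeff (n + 1) bernoulliSeries =
      -PowerSeries.coeff (n + 1) (uShiftInv ^ n) :=
  PowerSeries.natCast_mul_coeff_of_subst_eq uShiftInv_mul constantCoeff_uShift
    bernoulliSeries_subst n

/-- Coefficientwise partial derivative of a power series. -/
noncomputable def pderivSeries (m : ℕ+) (F : PowerSeries (MvPolynomial ℕ+ ℚ)) :
    PowerSeries (MvPolynomial ℕ+ ℚ) :=
  PowerSeries.mk fun n => pderiv m (PowerSeries.coeff n F)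

theorem pderivSeries_mul (m : ℕ+) (F H : PowerSeries (MvPolynomial ℕ+ ℚ)) :
    pderivSeries m (F * H) = pderivSeries m F * H + F * pderivSeries m H := by
  ext1 n
  simp only [pderivSeries, PowerSeries.coeff_mk, PowerSeries.coeff_mul, map_add, map_sum,
    pderiv_mul, Finset.sum_add_distrib]

theorem pderivSeries_one (m : ℕ+) : pderivSeries m 1 = 0 := by
  ext1 n
  simp only [pderivSeries, PowerSeries.coeff_mk, PowerSeries.coeff_one]
  split_ifs <;> simp

theorem pderivSeries_uShift (m : ℕ+) :
    pderivSeries m uShift =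
      PowerSeries.C (C (1 / (((m : ℕ) : ℚ) + 1))) * PowerSeries.X ^ (m : ℕ) := by
  ext1 n
  rw [PowerSeries.coeff_C_mul, PowerSeries.coeff_X_pow]
  simp only [pderivSeries, uShift, PowerSeries.coeff_mk, pderiv_C_mul]
  rcases Nat.eq_zero_or_pos n with rfl | hn
  · rw [c_zero, if_neg m.ne_zero.symm]
    simp
  · lift n to ℕ+ using hn
    simp only [c_coe, pderiv_X, PNat.coe_inj]
    rcases eq_or_ne n m with rfl | h
    · simp
    · simp [h]

theorem pderivSeries_uShiftInv_pow (m : ℕ+) (k : ℕ) :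
    pderivSeries m (uShiftInv ^ k) =
      -((k : PowerSeries (MvPolynomial ℕ+ ℚ)) * uShiftInv ^ (k + 1) * pderivSeries m uShift) := by
  have h1 : pderivSeries m uShiftInv = -(uShiftInv ^ 2 * pderivSeries m uShift) := by
    have h := congrArg (pderivSeries m) uShiftInv_mul
    rw [pderivSeries_one, pderivSeries_mul] at h
    linear_combination uShiftInv * h - pderivSeries m uShiftInv * uShiftInv_mul
  induction k with
  | zero => simp [pderivSeries_one]
  | succ k ih =>
    rw [pow_succ, pderivSeries_mul, ih, h1]
    push_cast
    ring

/-- The weight `∑ j U_j` of an exponent vector. -/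
noncomputable def weight (U : ℕ+ →₀ ℕ) : ℕ := Finsupp.weight (fun m : ℕ+ => (m : ℕ)) U

theorem weight_add (U V : ℕ+ →₀ ℕ) : weight (U + V) = weight U + weight V := map_add _ _ _

theorem weight_single (m : ℕ+) (e : ℕ) : weight (Finsupp.single m e) = e * m := by
  simp [weight, Finsupp.weight_single]

/-- The product `∏ (j+1)^(U_j) U_j!`. -/
def gam (U : ℕ+ →₀ ℕ) : ℕ := U.prod fun m e => ((m : ℕ) + 1) ^ e * e.factorial

theorem gam_ne_zero (U : ℕ+ →₀ ℕ) : gam U ≠ 0 :=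
  Finset.prod_ne_zero_iff.2 fun m _ => by positivity

theorem gam_eq_mul_erase (U : ℕ+ →₀ ℕ) (m : ℕ+) :
    gam U = ((m : ℕ) + 1) ^ U m * (U m).factorial * gam (U.erase m) :=
  (Finsupp.mul_prod_erase' U m _ (by simp)).symm

theorem gam_add_single (U : ℕ+ →₀ ℕ) (m : ℕ+) :
    gam (U + Finsupp.single m 1) = gam U * (((m : ℕ) + 1) * (U m + 1)) := by
  rw [gam_eq_mul_erase _ m, gam_eq_mul_erase U m]
  simp only [Finsupp.erase_add, Finsupp.erase_single, add_zero, Finsupp.add_apply,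
    Finsupp.single_eq_same, pow_succ, Nat.factorial_succ]
  ring

/-- This is the multinomial expansion of `(t/u)^(k+1)`, by induction on the degree of `U`:
differentiating in `c_m` removes one `c_m` and raises the exponent by one. In degree `0`, setting
every `c_m` to `0` makes `u/t` equal to `1`. -/
theorem coeff_coeff_uShiftInv_pow (U : ℕ+ →₀ ℕ) (n k : ℕ) :
    coeff U (PowerSeries.coeff n (uShiftInv ^ (k + 1))) * (k.factorial * gam U : ℚ) =
      if weight U = n then (-1) ^ U.degree * ((k + U.degree).factorial : ℚ) else 0 := by
  induction hd : U.degree generalizing U n k with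
  | zero =>
    obtain rfl : U = 0 := (Finsupp.degree_eq_zero_iff U).1 hd
    have hG : PowerSeries.map (constantCoeff (σ := ℕ+) (R := ℚ)) uShift = 1 := by
      ext n
      rw [PowerSeries.coeff_map, PowerSeries.coeff_one, uShift, PowerSeries.coeff_mk]
      rcases Nat.eq_zero_or_pos n with rfl | hn
      · simp [c_zero]
      · rw [if_neg hn.ne']
        lift n to ℕ+ using hn
        rw [c_coe, map_mul, constantCoeff_X, mul_zero]
    have hI : PowerSeries.map (constantCoeff (σ := ℕ+) (R := ℚ)) uShiftInv = 1 := by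
      have h := congrArg (PowerSeries.map (constantCoeff (σ := ℕ+) (R := ℚ))) uShiftInv_mul
      rwa [map_mul, hG, mul_one, map_one] at h
    have h := PowerSeries.coeff_map (constantCoeff (σ := ℕ+) (R := ℚ)) n (uShiftInv ^ (k + 1))
    rw [map_pow, hI, one_pow, PowerSeries.coeff_one] at h
    rw [← constantCoeff_eq, ← h]
    have hw : weight 0 = n ↔ n = 0 := by simp [weight, eq_comm]
    simp only [hw]
    split_ifs <;> simp [gam]
  | succ d ih =>
    obtain ⟨m, hm⟩ : ∃ m, U m ≠ 0 := by
      by_contra! h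
      have : U = 0 := Finsupp.ext h
      simp [this] at hd
    obtain ⟨U', rfl⟩ : ∃ U', U = U' + Finsupp.single m 1 :=
      ⟨U - Finsupp.single m 1, (tsub_add_cancel_of_le (by
        rw [Finsupp.single_le_iff]; omega)).symm⟩
    have hd' : U'.degree = d := by simpa using hd
    have h1 := congrArg (fun F => coeff U' (PowerSeries.coeff n F))
      (pderivSeries_uShiftInv_pow m (k + 1))
    simp only [pderivSeries_uShift] at h1
    rw [pderivSeries, PowerSeries.coeff_mk, coeff_pderiv,
      show -(((k + 1 : ℕ) : PowerSeries (MvPolynomial ℕ+ ℚ)) * uShiftInv ^ (k + 1 + 1) *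
          (PowerSeries.C (C (1 / (((m : ℕ) : ℚ) + 1))) * PowerSeries.X ^ (m : ℕ))) =
        PowerSeries.C (C (-((k + 1 : ℕ) : ℚ) / (((m : ℕ) : ℚ) + 1))) *
          (uShiftInv ^ (k + 1 + 1) * PowerSeries.X ^ (m : ℕ)) by
        rw [div_eq_mul_one_div (-((k + 1 : ℕ) : ℚ)), C_mul, C_neg, map_mul, map_neg, map_natCast, map_natCast]
        ring,
      PowerSeries.coeff_C_mul, PowerSeries.coeff_mul_X_pow', coeff_C_mul] at h1
    have hm1 : ((m : ℕ) : ℚ) + 1 ≠ 0 := by positivity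
    have hw : weight (U' + Finsupp.single m 1) = weight U' + m := by
      rw [weight_add, weight_single, one_mul]
    rw [gam_add_single, hw]
    push_cast
    split_ifs at h1 with hmn
    · have h2 := ih U' (n - m) (k + 1) hd'
      have hiff : weight U' = n - m ↔ weight U' + m = n := by omega
      simp only [hiff] at h2
      rw [Nat.factorial_succ] at h2
      have h3 : coeff (U' + Finsupp.single m 1) (PowerSeries.coeff n (uShiftInv ^ (k + 1))) *
          (k.factorial * (gam U' * (((m : ℕ) + 1) * (U' m + 1))) : ℚ) =
          -(coeff U' (PowerSeries.coeff (n - m) (uShiftInv ^ (k + 1 + 1))) *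
            (((k + 1) * k.factorial : ℕ) * gam U' : ℚ)) := by
        rw [show coeff (U' + Finsupp.single m 1) (PowerSeries.coeff n (uShiftInv ^ (k + 1))) *
          (k.factorial * (gam U' * (((m : ℕ) + 1) * (U' m + 1))) : ℚ) =
          coeff (U' + Finsupp.single m 1) (PowerSeries.coeff n (uShiftInv ^ (k + 1))) *
          (U' m + 1) * (k.factorial * (gam U' * (((m : ℕ) + 1))) : ℚ) by ring, h1]
        field_simp
        push_cast
        ring
      rw [h3, h2]
      split_ifs
      · rw [pow_succ, show k + 1 + d = k + (d + 1) by ring]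
        ring
      · ring
    · have h4 : ¬ weight U' + m = n := by omega
      rw [coeff_zero, mul_zero] at h1
      rw [if_neg h4]
      linear_combination (k.factorial * (gam U' * (((m : ℕ) + 1))) : ℚ) * h1

/-- Clarke's formula for the coefficients of the divided universal Bernoulli numbers. -/
theorem coeff_divided_univBernoulli (U : ℕ+ →₀ ℕ) {n : ℕ} (hn : 2 ≤ n) :
    coeff U (C (1 / (n : ℚ)) * univBernoulli n) =
      if weight U = n then
        (-1) ^ (U.degree + 1) * ((n + U.degree - 2).factorial : ℚ) / gam U else 0 := by
  obtain ⟨k, rfl⟩ : ∃ k, n = k + 1 + 1 := ⟨n - 2, by omega⟩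
  have h1 := coeff_coeff_uShiftInv_pow U (k + 1 + 1) k
  have h2 := congrArg (coeff U) (natCast_mul_coeff_bernoulliSeries (k + 1))
  rw [← map_natCast (C (R := ℚ) (σ := ℕ+)), coeff_C_mul, coeff_neg] at h2
  have hg : (gam U : ℚ) ≠ 0 := Nat.cast_ne_zero.2 (gam_ne_zero U)
  have h3 : (((k + 1 + 1 : ℕ)) : ℚ) ≠ 0 := by positivity
  rw [univBernoulli, ← mul_assoc, ← C_mul, coeff_C_mul, Nat.factorial_succ, Nat.cast_mul,
    one_div, inv_mul_cancel_left₀ h3, Nat.factorial_succ, Nat.cast_mul, mul_comm ((k + 1 : ℕ) : ℚ),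
    mul_assoc, h2, show k + 1 + 1 + U.degree - 2 = k + U.degree by omega]
  have h4 : (k.factorial : ℚ) * -coeff U (PowerSeries.coeff (k + 1 + 1) (uShiftInv ^ (k + 1))) =
      -(if weight U = k + 1 + 1 then (-1) ^ U.degree * ((k + U.degree).factorial : ℚ) else 0) /
        gam U := by
    rw [← h1]
    field_simp
  rw [h4]
  split_ifs
  · rw [pow_succ]
    ring
  · simp

end UnivBernoulli

/-! ### Coefficients of the Kummer sum and the conclusion. -/

namespace UnivBernoulli

open MvPolynomial

theorem div_pow_mem_zLoc {p : ℕ} [Fact p.Prime] {x : ℤ} {g k : ℕ} (hg : g ≠ 0)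
    (h : (p : ℤ) ^ (g.factorization p + k) ∣ x) : (x : ℚ) / g / (p : ℚ) ^ k ∈ zLoc p := by
  have hp : p.Prime := Fact.out
  obtain ⟨z, rfl⟩ := h
  obtain ⟨g', hg'⟩ := Nat.ordProj_dvd g p
  have hndvd : ¬ p ∣ g' := by
    have h1 := Nat.not_dvd_ordCompl hp hg
    rwa [Nat.div_eq_of_eq_mul_right (pow_pos hp.pos _) hg'] at h1
  have hg0 : (g' : ℚ) ≠ 0 := Nat.cast_ne_zero.2 (by rintro rfl; simp at hndvd)
  have hp0 : (p : ℚ) ≠ 0 := Nat.cast_ne_zero.2 hp.ne_zero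
  have he : (((p : ℤ) ^ (g.factorization p + k) * z : ℤ) : ℚ) / g / (p : ℚ) ^ k =
      ((z : ℤ) : ℚ) / ((g' : ℤ) : ℚ) := by
    have hgq : (g : ℚ) = (p : ℚ) ^ g.factorization p * g' := by exact_mod_cast hg'
    rw [hgq]
    push_cast
    rw [pow_add]
    field_simp
  rw [he, mem_zLoc_iff, hp.coprime_iff_not_dvd]
  intro hd
  exact hndvd (hd.trans (Int.natCast_dvd_natCast.1 (Rat.divInt_eq_div z g' ▸ Rat.den_dvd z g')))

theorem congZero_of_coeff {p : ℕ} [Fact p.Prime] {k : ℕ} {f : MvPolynomial ℕ+ ℚ}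
    (h : ∀ V, coeff V f / (p : ℚ) ^ k ∈ zLoc p) : CongZero p k f := by
  have hp0 : (p : ℚ) ^ k ≠ 0 := pow_ne_zero _ (Nat.cast_ne_zero.2 (Fact.out : p.Prime).ne_zero)
  have hmem : C (((p : ℚ) ^ k)⁻¹) * f ∈ Set.range (MvPolynomial.map (σ := ℕ+) (zLoc p).subtype) := by
    refine mem_range_map_iff_coeffs_subset.2 fun x hx => ?_
    obtain ⟨V, -, rfl⟩ := mem_coeffs_iff.1 hx
    refine ⟨⟨_, h V⟩, ?_⟩
    rw [coeff_C_mul, inv_mul_eq_div]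
    rfl
  obtain ⟨g, hg⟩ := hmem
  refine ⟨g, ?_⟩
  rw [hg, ← mul_assoc, ← C_mul, mul_inv_cancel₀ hp0, C_1, one_mul]

theorem weight_add_degree (W : ℕ+ →₀ ℕ) :
    weight W + W.degree = ∑ i ∈ W.support, ((i : ℕ) + 1) * W i := by
  rw [weight, Finsupp.weight_apply, Finsupp.sum, Finsupp.degree_apply, ← Finset.sum_add_distrib]
  refine Finset.sum_congr rfl fun i _ => ?_
  rw [smul_eq_mul]
  ring

theorem exists_not_modEq_of_weight {d : ℕ} {W : ℕ+ →₀ ℕ} (h : ¬ weight W ≡ 0 [MOD d]) :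
    ∃ i ∈ W.support, W i ≠ 0 ∧ ¬ (i : ℕ) + 1 ≡ 1 [MOD d] := by
  by_contra! hc
  apply h
  rw [weight, Finsupp.weight_apply, Finsupp.sum, Nat.modEq_zero_iff_dvd]
  refine Finset.dvd_sum fun i hi => Dvd.dvd.mul_left ?_ _
  have h1 := hc i hi (Finsupp.mem_support_iff.1 hi)
  rw [← Nat.modEq_zero_iff_dvd]
  exact Nat.ModEq.add_right_cancel' 1 h1

theorem factorization_gam_le {p : ℕ} (hp : p.Prime) (hp3 : 3 ≤ p) {W : ℕ+ →₀ ℕ} {N : ℕ}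
    (hW : ∀ i : ℕ+, (i : ℕ) + 1 = p → W i = 0) (hw : ¬ weight W ≡ 0 [MOD (p - 1)])
    (hN : weight W + W.degree = N + 2) :
    (gam W).factorization p + N / p / 2 ≤ N.factorial.factorization p :=
  factorization_centralizer_le hp hp3 W.support (fun i => (i : ℕ) + 1) W
    (fun i _ => Nat.succ_le_succ (one_le (a := i))) (fun i hi h => Finsupp.mem_support_iff.1 hi (hW i h))
    (exists_not_modEq_of_weight hw) (by rw [← hN, weight_add_degree])

/-- Up to a factor not depending on `s`, the coefficient in Clarke's formula is a
binomial coefficient times a product of integers prime to `p`. -/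
theorem factorial_div_gam_add_single {p : ℕ} (hp : p.Prime) {W : ℕ+ →₀ ℕ} {P : ℕ+}
    (hP : (P : ℕ) + 1 = p) (hW : W P = 0) (N s : ℕ) :
    ((N + p * s).factorial : ℚ) / gam (W + Finsupp.single P s) =
      ((p ^ (N / p) * (N / p).factorial : ℕ) : ℚ) / gam W *
        ((N / p + s).choose (N / p) * primeToFactorial p (N % p + p * (N / p + s))) := by
  have hg : gam (W + Finsupp.single P s) = p ^ s * s.factorial * gam W := by
    rw [gam_eq_mul_erase _ P, Finsupp.erase_add, Finsupp.erase_single, add_zero,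
      Finsupp.erase_of_notMem_support (Finsupp.notMem_support_iff.2 hW), Finsupp.add_apply, hW,
      Finsupp.single_eq_same, zero_add, hP]
  have hdiv : (N + p * s) / p = N / p + s := Nat.add_mul_div_left _ _ hp.pos
  have hN : N % p + p * (N / p + s) = N + p * s := by
    rw [mul_add, ← add_assoc, Nat.mod_add_div]
  have hf := factorial_eq_pow_mul_primeToFactorial p (N + p * s)
  have hc := Nat.add_choose_mul_factorial_mul_factorial s (N / p)
  rw [add_comm s] at hc
  rw [hdiv, ← hc] at hf
  rw [hg, hf, hN]
  have h1 : (gam W : ℚ) ≠ 0 := Nat.cast_ne_zero.2 (gam_ne_zero W)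
  have h2 : (p : ℚ) ≠ 0 := Nat.cast_ne_zero.2 hp.ne_zero
  have h3 : (s.factorial : ℚ) ≠ 0 := Nat.cast_ne_zero.2 s.factorial_ne_zero
  push_cast
  rw [pow_add]
  field_simp

theorem coeff_kummer_summand {P : ℕ+} {p a n r : ℕ} (hP : (P : ℕ) = p - 1) (V : ℕ+ →₀ ℕ)
    (hn : 2 ≤ n + r * (p - 1)) :
    coeff V ((a.choose r : MvPolynomial ℕ+ ℚ) * (-1) ^ r * c (p - 1) ^ (a - r) *
      (C (1 / ((n + r * (p - 1) : ℕ) : ℚ)) * univBernoulli (n + r * (p - 1)))) =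
    (a.choose r : ℚ) * (-1) ^ r * if a - r ≤ V P then
      (if weight (V - Finsupp.single P (a - r)) = n + r * (p - 1) then
        (-1) ^ ((V - Finsupp.single P (a - r)).degree + 1) *
          ((n + r * (p - 1) + (V - Finsupp.single P (a - r)).degree - 2).factorial : ℚ) /
            gam (V - Finsupp.single P (a - r)) else 0) else 0 := by
  have hC : (a.choose r : MvPolynomial ℕ+ ℚ) * (-1) ^ r = C ((a.choose r : ℚ) * (-1) ^ r) := by
    simp
  rw [hC, ← hP, c_coe, mul_assoc, coeff_C_mul, X_pow_eq_monomial, coeff_monomial_mul', one_mul, hP,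
    coeff_divided_univBernoulli _ hn]
  simp only [Finsupp.single_le_iff]

/-- The coefficients of the Kummer sum as iterated differences. -/
theorem coeff_kummer_sum {P : ℕ+} {p a n N t₀ : ℕ} (hp : p.Prime) (hP : (P : ℕ) = p - 1)
    (hn : 2 ≤ n) (W : ℕ+ →₀ ℕ) (hW : W P = 0) (m : ℕ)
    (hw : weight W + m * (p - 1) = n + a * (p - 1)) (hN : weight W + W.degree = N + 2)
    (ht : t₀ + a = N / p + m) :
    coeff (W + Finsupp.single P m) (∑ r ∈ Finset.range (a + 1),
        (a.choose r : MvPolynomial ℕ+ ℚ) * (-1) ^ r * c (p - 1) ^ (a - r) *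
          (C (1 / ((n + r * (p - 1) : ℕ) : ℚ)) * univBernoulli (n + r * (p - 1)))) =
      (((-1) ^ (W.degree + 1 + N / p + a) * ((p ^ (N / p) * (N / p).factorial : ℕ) : ℤ) *
        (fwdDiff 1)^[a] (fun t : ℕ => (t.choose (N / p) : ℤ) *
          ((-1 : ℤ) ^ t * primeToFactorial p (N % p + p * t))) t₀ : ℤ) : ℚ) / gam W := by
  rw [coeff_sum, fwdDiff_iter_eq_sum_shift, Finset.mul_sum, Int.cast_sum, Finset.sum_div]
  refine Finset.sum_congr rfl fun r hr => ?_
  have hra : r ≤ a := Nat.lt_succ_iff.1 (Finset.mem_range.1 hr)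
  rw [coeff_kummer_summand hP _ (by omega), Finsupp.add_apply, hW, Finsupp.single_eq_same, zero_add]
  obtain ⟨b, rfl⟩ := Nat.exists_eq_add_of_le hra
  rw [Nat.add_sub_cancel_left]
  split_ifs with h1 h2
  · obtain ⟨s, rfl⟩ := Nat.exists_eq_add_of_le h1
    have hU : W + Finsupp.single P (b + s) - Finsupp.single P b = W + Finsupp.single P s := by
      rw [add_comm b, Finsupp.single_add, ← add_assoc, add_tsub_cancel_right]
    have hdeg : (W + Finsupp.single P s).degree = W.degree + s := by simp
    have hK : n + r * (p - 1) + (W.degree + s) - 2 = N + p * s := by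
      have hps : p * s = s * (p - 1) + s := by
        obtain ⟨p', rfl⟩ : ∃ p', p = p' + 1 := ⟨p - 1, by have := hp.pos; omega⟩
        rw [Nat.add_sub_cancel]
        ring
      rw [hU, weight_add, weight_single, hP] at h2
      omega
    have ht' : t₀ + r • 1 = N / p + s := by
      rw [smul_eq_mul]
      omega
    have hsign : (-1 : ℚ) ^ (W.degree + 1 + N / p + (r + b)) * (-1) ^ b * (-1) ^ (N / p + s) =
        (-1) ^ r * (-1) ^ (W.degree + s + 1) := by
      rw [← pow_add, ← pow_add, ← pow_add, show W.degree + 1 + N / p + (r + b) + b + (N / p + s) =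
        r + (W.degree + s + 1) + 2 * (N / p + b) by ring, pow_add, pow_mul]
      simp
    rw [hU, hdeg, hK, ht', mul_div_assoc, factorial_div_gam_add_single hp (by
      rw [hP, Nat.sub_add_cancel hp.one_le]) hW, smul_eq_mul]
    push_cast
    rw [show ((r + b).choose r : ℚ) * (-1) ^ r * ((-1) ^ (W.degree + s + 1) *
      ((p : ℚ) ^ (N / p) * (N / p).factorial / gam W * ((N / p + s).choose (N / p) *
        primeToFactorial p (N % p + p * (N / p + s))))) =
      ((-1) ^ r * (-1) ^ (W.degree + s + 1)) * ((r + b).choose r *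
      ((p : ℚ) ^ (N / p) * (N / p).factorial / gam W * ((N / p + s).choose (N / p) *
        primeToFactorial p (N % p + p * (N / p + s))))) by ring, ← hsign]
    ring
  · exfalso
    obtain ⟨s, rfl⟩ := Nat.exists_eq_add_of_le h1
    apply h2
    have hU : W + Finsupp.single P (b + s) - Finsupp.single P b = W + Finsupp.single P s := by
      rw [add_comm b, Finsupp.single_add, ← add_assoc, add_tsub_cancel_right]
    rw [hU, weight_add, weight_single, hP]
    simp only [add_mul] at hw
    omega
  -- Here `c_{p-1}^(a-r)` does not divide the monomial; correspondingly `t₀ + r < N / p`, so the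
  -- binomial coefficient vanishes too.
  · have h0 : (t₀ + r • 1).choose (N / p) = 0 := by
      apply Nat.choose_eq_zero_of_lt
      rw [smul_eq_mul]
      omega
    rw [h0]
    simp

end UnivBernoulli

theorem theorem3p1p1 (p : ℕ) [Fact p.Prime] (a n : ℕ) (ha : 1 ≤ a) (han : a < n)
    (hn : ¬ n ≡ 0 [MOD (p - 1)]) :
    UnivBernoulli.CongZero p (a / 2)
      (∑ r ∈ Finset.range (a + 1),
        (a.choose r : MvPolynomial ℕ+ ℚ) * (-1) ^ r * UnivBernoulli.c (p - 1) ^ (a - r) *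
          (MvPolynomial.C (1 / ((n + r * (p - 1) : ℕ) : ℚ)) *
            UnivBernoulli.univBernoulli (n + r * (p - 1)))) := by
  have hp : p.Prime := Fact.out
  have hp3 : 3 ≤ p := by
    by_contra! h
    obtain rfl : p = 2 := by have := hp.two_le; omega
    exact hn (Nat.modEq_one)
  obtain ⟨P, hP⟩ : ∃ P : ℕ+, (P : ℕ) = p - 1 := ⟨⟨p - 1, by omega⟩, rfl⟩
  refine UnivBernoulli.congZero_of_coeff fun V => ?_
  by_cases hV : UnivBernoulli.weight V = n + a * (p - 1)
  swap
  · rw [MvPolynomial.coeff_sum, Finset.sum_eq_zero, zero_div]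
    · exact zero_mem _
    intro r hr
    have hra : r ≤ a := Nat.lt_succ_iff.1 (Finset.mem_range.1 hr)
    rw [UnivBernoulli.coeff_kummer_summand hP V (by omega)]
    split_ifs with h1 h2
    · exfalso
      apply hV
      have h3 := tsub_add_cancel_of_le (Finsupp.single_le_iff.2 h1)
      rw [← h3, UnivBernoulli.weight_add, UnivBernoulli.weight_single, h2, hP, add_assoc,
        ← add_mul, Nat.add_sub_cancel' hra]
    · rw [mul_zero]
    · rw [mul_zero]
  obtain ⟨W, m, hW, rfl⟩ : ∃ W m, W P = 0 ∧ V = W + Finsupp.single P m :=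
    ⟨V.erase P, V P, Finsupp.erase_same, (Finsupp.erase_add_single P V).symm⟩
  rw [UnivBernoulli.weight_add, UnivBernoulli.weight_single, hP] at hV
  have hw : ¬ UnivBernoulli.weight W ≡ 0 [MOD (p - 1)] := by
    intro h
    apply hn
    rw [Nat.modEq_zero_iff_dvd] at h ⊢
    have h1 : p - 1 ∣ n + a * (p - 1) := hV ▸ dvd_add h (dvd_mul_left _ _)
    exact (Nat.dvd_add_left (dvd_mul_left _ _)).1 h1
  have hdeg : 1 ≤ W.degree := by
    rw [Nat.one_le_iff_ne_zero, Ne, Finsupp.degree_eq_zero_iff]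
    rintro rfl
    exact hw (by simp [UnivBernoulli.weight, Nat.ModEq])
  have hwt : 1 ≤ UnivBernoulli.weight W := by
    rw [Nat.one_le_iff_ne_zero]
    intro h
    exact hw (by rw [h])
  obtain ⟨N, hN⟩ : ∃ N, UnivBernoulli.weight W + W.degree = N + 2 :=
    ⟨UnivBernoulli.weight W + W.degree - 2, by omega⟩
  -- This is where `a < n` enters: it makes the base point `t₀ = N / p + m - a` a natural number.
  have hq : a ≤ N / p + m := by
    rcases le_or_gt a m with h | h
    · exact h.trans (Nat.le_add_left _ _)
    obtain ⟨j, rfl⟩ := Nat.exists_eq_add_of_lt h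
    have h1 : j + 1 ≤ N / p := by
      rw [Nat.le_div_iff_mul_le hp.pos]
      have h2 : (j + 1) * p = (j + 1) * (p - 1) + (j + 1) := by
        conv_lhs => rw [← Nat.sub_add_cancel hp.one_le]
        ring
      rw [add_assoc m, add_mul] at hV
      omega
    omega
  obtain ⟨t₀, ht⟩ : ∃ t₀, t₀ + a = N / p + m := ⟨N / p + m - a, by omega⟩
  rw [UnivBernoulli.coeff_kummer_sum hp hP (by omega) W hW m hV hN ht]
  refine UnivBernoulli.div_pow_mem_zLoc (UnivBernoulli.gam_ne_zero W) ?_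
  have hA := UnivBernoulli.factorization_gam_le hp hp3 (W := W) (N := N)
    (fun i hi => by rwa [show i = P from PNat.eq (by omega)]) hw hN
  have hv : (p ^ (N / p) * (N / p).factorial).factorization p =
      N.factorial.factorization p := by
    rw [factorization_factorial_div hp N, Nat.factorization_mul
      (pow_ne_zero _ hp.ne_zero) (Nat.factorial_ne_zero _)]
    simp [hp.factorization_self]
  have hd1 : (p : ℤ) ^ N.factorial.factorization p ∣
      ((p ^ (N / p) * (N / p).factorial : ℕ) : ℤ) := by
    rw [← hv]
    exact_mod_cast Nat.ordProj_dvd _ p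
  have hd2 := pow_dvd_fwdDiff_iter_choose_mul p (N % p) (N / p) a t₀
  have hd := mul_dvd_mul (hd1.mul_left ((-1) ^ (W.degree + 1 + N / p + a))) hd2
  rw [← pow_add] at hd
  -- With `q = N / p`: `⌊q/2⌋ + ⌈(a-q)/2⌉ ≥ ⌊a/2⌋`, where the subtraction is truncated.
  exact (pow_dvd_pow _ (by omega)).trans hd
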